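/- Let $X$ be a complex Banach space and let $T\in\mathcal{B}(X)$ be power-bounded, that is, $\sup_{n\ge0}\|T^n\|<\infty$. Suppose that $\sigma(T)\cap\mathbb{T}=\{1\}$, where $\sigma(T)$ is the spectrum of $T$ and $\mathbb{T}=\{\lambda\in\mathbb{C}:|\lambda|=1\}$. Let $m:(0,\pi]\to[1,\infty)$ be a continuous non-increasing function such that $$\|R(e^{i\theta},T)\|\le m(|\theta|),\qquad 0<|\theta|\le\pi,$$ where $R(\lambda,T)=(\lambda I-T)^{-1}$. Define $$m_{\log}(\varepsilon)=m(\varepsilon)\log\left(1+\frac{m(\varepsilon)}{\varepsilon}\right),\qquad 0<\varepsilon\le\pi.$$ This map is strictly decreasing on $(0,\pi]$; let $m_{\log}^{-1}$ be its inverse function, defined on its range. Then, for every $c\in(0,1)$, the number $cn$ lies in the range of $m_{\log}$ for all sufficiently large $n$, and $$\|T^n(I-T)\|=O\big(m_{\log}^{-1}(cn)\big),\qquad n\to\infty,$$ that is, there is a constant $C>0$ such that $\|T^n(I-T)\|\le C\,m_{\log}^{-1}(cn)$ for all sufficiently large $n$. -/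

import Mathlib

open Filter Asymptotics Set

/-- `T` is power-bounded: `sup_{n ≥ 0} ‖T ^ n‖ < ∞`. -/
def IsPowerBounded {X : Type*} [NormedAddCommGroup X] [NormedSpace ℂ X] (T : X →L[ℂ] X) : Prop :=
  BddAbove (range fun n : ℕ => ‖T ^ n‖)

/-- `m_log(ε) = m(ε) log (1 + m(ε) / ε)`, of interest for `0 < ε ≤ π`. -/
noncomputable def mLog (m : ℝ → ℝ) (ε : ℝ) : ℝ :=
  m ε * Real.log (1 + m ε / ε)

/-- The inverse function of the map `m_log` on `(0, π]`; for `t` in the range of that map this is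
the unique `ε ∈ (0, π]` with `m_log(ε) = t`. -/
noncomputable def mLogInv (m : ℝ → ℝ) (t : ℝ) : ℝ :=
  Function.invFunOn (mLog m) (Ioc 0 Real.pi) t

/-- For non-increasing `m ≥ 1`, the map `m_log` is strictly decreasing on `(0, π]`, so that it has
an inverse function defined on its range. -/
theorem mLog_strictAntiOn {m : ℝ → ℝ} (hanti : AntitoneOn m (Ioc 0 Real.pi))
    (hone : ∀ ε ∈ Ioc 0 Real.pi, 1 ≤ m ε) : StrictAntiOn (mLog m) (Ioc 0 Real.pi) := by
  intro a ha b hb hab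
  have h1 := hanti ha hb hab.le
  have h2 := hone b hb
  have ha0 : 0 < a := ha.1
  have hb0 : 0 < b := hb.1
  have h3 : m b / b < m a / a := by
    calc m b / b < m b / a := div_lt_div_of_pos_left (by linarith) ha0 hab
      _ ≤ m a / a := by gcongr
  have h4 : 0 < m b / b := by positivity
  have h5 : Real.log (1 + m b / b) < Real.log (1 + m a / a) :=
    Real.log_lt_log (by linarith) (by linarith)
  have h6 : 0 < Real.log (1 + m b / b) := Real.log_pos (by linarith)
  unfold mLog
  nlinarith

theorem mLogInv_mLog {m : ℝ → ℝ} (hanti : AntitoneOn m (Ioc 0 Real.pi))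
    (hone : ∀ ε ∈ Ioc 0 Real.pi, 1 ≤ m ε) {ε : ℝ} (hε : ε ∈ Ioc 0 Real.pi) :
    mLogInv m (mLog m ε) = ε :=
  (mLog_strictAntiOn hanti hone).injOn.leftInvOn_invFunOn hε

/-! A Newman-type contour argument. Let `w = e^{iε}`, `κ = 2 - w - w⁻¹` and `M = m ε`, where `ε`
solves `mLog m ε = c n`. Integrating `newmanKernel w l` times `T^n R(l)` over a circle outside the
unit disc gives `T^n (1 - T - κ)`; since `|κ| ≤ ε²`, the term `κ T^n` is harmless. Near `1` only
power-boundedness is used: `‖T^n R(l)‖ ≤ K / (|l| - 1)` outside the disc, and the polynomial part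
`p_n(l) = l^n R(l) - T^n R(l)` is at most `K / (1 - |l|)` inside. Away from `1` the two parts are
separated: `p_n` is returned to the front arc inside the disc by Cauchy's theorem, while `l^n R(l)`
is pushed inside to `|l| = e^{-α}`, `α = c / M`, where a Neumann series keeps `‖R‖ ≤ M / (1 - c)`.
The radial edges pass through the zeros `w`, `w⁻¹` of the kernel, which absorb the blow-up at the
unit circle. The total is `O(ε + M e^{-nα} + 1/n)`. The choice of `ε` means `nα = log (1 + M/ε)`, so
`M e^{-nα} ≤ ε`; and `1 ∈ σ(T)` forces `M ≥ 1/ε`, whence `1/n = O(ε)`. The core is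
`norm_pow_mul_smul_one_sub_le`; the parameters are chosen in `norm_pow_mul_one_sub_le_of_mLog_eq`.
-/

/-! ### Resolvent identities and bounds from power-boundedness. -/

section Resolvent

variable {A : Type*} [NormedRing A] [NormedAlgebra ℂ A] {a : A}

theorem resolvent_mul_sub_algebraMap {l : ℂ} (hl : l ∈ resolventSet ℂ a) :
    resolvent a l * (algebraMap ℂ A l - a) = 1 :=
  Ring.inverse_mul_cancel _ hl

theorem sub_algebraMap_mul_resolvent {l : ℂ} (hl : l ∈ resolventSet ℂ a) :
    (algebraMap ℂ A l - a) * resolvent a l = 1 :=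
  Ring.mul_inverse_cancel _ hl

theorem smul_resolvent_eq {l : ℂ} (hl : l ∈ resolventSet ℂ a) :
    l • resolvent a l = 1 + a * resolvent a l := by
  have h := sub_algebraMap_mul_resolvent hl
  rw [sub_mul, Algebra.algebraMap_eq_smul_one, smul_mul_assoc, one_mul] at h
  rw [← h]; abel

theorem norm_sum_pow_smul_pow_le {K : ℝ} (hK : ∀ n : ℕ, ‖a ^ n‖ ≤ K) (n : ℕ) {l : ℂ}
    (hl : ‖l‖ < 1) :
    ‖∑ i ∈ Finset.range n, l ^ i • a ^ (n - 1 - i)‖ ≤ K / (1 - ‖l‖) := by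
  have hK0 : 0 ≤ K := (norm_nonneg _).trans (hK 0)
  calc ‖∑ i ∈ Finset.range n, l ^ i • a ^ (n - 1 - i)‖
      ≤ ∑ i ∈ Finset.range n, ‖l‖ ^ i * K := by
        refine norm_sum_le_of_le _ fun i _ => ?_
        rw [norm_smul, norm_pow]
        gcongr
        exact hK _
    _ = (∑ i ∈ Finset.range n, ‖l‖ ^ i) * K := by rw [Finset.sum_mul]
    _ ≤ (1 - ‖l‖)⁻¹ * K := by
        gcongr
        rw [← tsum_geometric_of_lt_one (norm_nonneg _) hl]
        exact (summable_geometric_of_lt_one (norm_nonneg _) hl).sum_le_tsum _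
          fun i _ => by positivity
    _ = K / (1 - ‖l‖) := by rw [div_eq_inv_mul]

/-- `T ^ n R(l) = l ^ n R(l) - p_n(l)` with the polynomial `p_n(l) = ∑ l ^ i T ^ (n - 1 - i)`. -/
theorem pow_mul_resolvent {l : ℂ} (hl : l ∈ resolventSet ℂ a) (n : ℕ) :
    a ^ n * resolvent a l =
      l ^ n • resolvent a l - ∑ i ∈ Finset.range n, l ^ i • a ^ (n - 1 - i) := by
  have h := Commute.geom_sum₂_mul (Algebra.commutes l a) n
  have h2 : (∑ i ∈ Finset.range n, (algebraMap ℂ A l) ^ i * a ^ (n - 1 - i)) =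
      ∑ i ∈ Finset.range n, l ^ i • a ^ (n - 1 - i) := by
    refine Finset.sum_congr rfl fun i _ => ?_
    rw [← map_pow, Algebra.smul_def]
  rw [h2] at h
  have h3 := congrArg (· * resolvent a l) h
  simp only [mul_assoc, sub_algebraMap_mul_resolvent hl, mul_one, sub_mul] at h3
  rw [h3, ← map_pow, ← Algebra.smul_def]; abel

variable [CompleteSpace A]

/-- Neumann series: the resolvent set contains a disc of radius `1 / ‖R(μ)‖` around `μ`. -/
theorem mem_resolventSet_of_norm_sub_mul_lt {l μ : ℂ} (hμ : μ ∈ resolventSet ℂ a)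
    (h : ‖μ - l‖ * ‖resolvent a μ‖ < 1) : l ∈ resolventSet ℂ a := by
  have hu : IsUnit (1 - (μ - l) • resolvent a μ) :=
    (Units.oneSub _ (by rwa [norm_smul])).isUnit
  have he : algebraMap ℂ A l - a =
      (algebraMap ℂ A μ - a) * (1 - (μ - l) • resolvent a μ) := by
    rw [mul_sub, mul_one, mul_smul_comm, sub_algebraMap_mul_resolvent hμ,
      Algebra.algebraMap_eq_smul_one, Algebra.algebraMap_eq_smul_one, sub_smul]
    abel
  rw [spectrum.mem_resolventSet_iff, he]
  exact IsUnit.mul hμ hu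

theorem norm_resolvent_le_of_norm_sub_mul_le {l μ : ℂ} {M δ : ℝ} (hμ : μ ∈ resolventSet ℂ a)
    (hM : ‖resolvent a μ‖ ≤ M) (hδ : δ < 1) (h : ‖μ - l‖ * M ≤ δ) :
    l ∈ resolventSet ℂ a ∧ ‖resolvent a l‖ ≤ M / (1 - δ) := by
  have h1 : ‖μ - l‖ * ‖resolvent a μ‖ ≤ δ :=
    (mul_le_mul_of_nonneg_left hM (norm_nonneg _)).trans h
  have hl := mem_resolventSet_of_norm_sub_mul_lt hμ (h1.trans_lt hδ)
  refine ⟨hl, ?_⟩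
  have he : resolvent a l = resolvent a μ + (μ - l) • (resolvent a l * resolvent a μ) := by
    calc resolvent a l = resolvent a l * ((algebraMap ℂ A μ - a) * resolvent a μ) := by
          rw [sub_algebraMap_mul_resolvent hμ, mul_one]
      _ = resolvent a l * ((algebraMap ℂ A l - a) + (μ - l) • (1 : A)) * resolvent a μ := by
          rw [mul_assoc]; congr 2
          rw [Algebra.algebraMap_eq_smul_one, Algebra.algebraMap_eq_smul_one, sub_smul]; abel
      _ = _ := by
          rw [mul_add, resolvent_mul_sub_algebraMap hl, add_mul, one_mul, mul_smul_comm, mul_one,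
            smul_mul_assoc]
  have hn : ‖resolvent a l‖ ≤ M + δ * ‖resolvent a l‖ := by
    calc ‖resolvent a l‖ = ‖resolvent a μ + (μ - l) • (resolvent a l * resolvent a μ)‖ := by
          rw [← he]
      _ ≤ ‖resolvent a μ‖ + ‖(μ - l) • (resolvent a l * resolvent a μ)‖ := norm_add_le _ _
      _ ≤ M + ‖μ - l‖ * (‖resolvent a l‖ * ‖resolvent a μ‖) := by
          rw [norm_smul]; gcongr; exact norm_mul_le _ _
      _ = M + (‖μ - l‖ * ‖resolvent a μ‖) * ‖resolvent a l‖ := by ring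
      _ ≤ _ := by gcongr
  rw [le_div_iff₀ (by linarith)]
  linarith

/-- The expansion `a^n R(l) = ∑ a^(n+i) / l^(i+1)` is bounded term by term, which makes the estimate
uniform in `n`. -/
theorem mem_resolventSet_and_norm_pow_mul_resolvent_le {K : ℝ} (hK : ∀ n : ℕ, ‖a ^ n‖ ≤ K)
    {l : ℂ} (hl : 1 < ‖l‖) :
    l ∈ resolventSet ℂ a ∧ ∀ n : ℕ, ‖a ^ n * resolvent a l‖ ≤ K / (‖l‖ - 1) := by
  have hK0 : 0 ≤ K := (norm_nonneg _).trans (hK 0)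
  have hl0 : l ≠ 0 := fun h => by norm_num [h] at hl
  have hq : ‖l‖⁻¹ < 1 := inv_lt_one_of_one_lt₀ hl
  have hb : ∀ i n : ℕ, ‖a ^ n * (l⁻¹ • a) ^ i‖ ≤ ‖l‖⁻¹ ^ i * K := fun i n => by
    rw [smul_pow, mul_smul_comm, norm_smul, norm_pow, norm_inv, ← pow_add]
    gcongr
    exact hK _
  have hgs : Summable fun i : ℕ => ‖l‖⁻¹ ^ i * K :=
    (summable_geometric_of_lt_one (by positivity) hq).mul_right K
  have hs : Summable fun i : ℕ => (l⁻¹ • a) ^ i :=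
    Summable.of_norm_bounded hgs fun i => by simpa using hb i 0
  have he : algebraMap ℂ A l - a = l • (1 - l⁻¹ • a) := by
    rw [smul_sub, smul_smul, mul_inv_cancel₀ hl0, one_smul, Algebra.algebraMap_eq_smul_one]
  have h1 : (algebraMap ℂ A l - a) * (l⁻¹ • ∑' i : ℕ, (l⁻¹ • a) ^ i) = 1 := by
    rw [he, smul_mul_smul_comm, mul_inv_cancel₀ hl0, one_smul, hs.one_sub_mul_tsum_pow]
  have h2 : (l⁻¹ • ∑' i : ℕ, (l⁻¹ • a) ^ i) * (algebraMap ℂ A l - a) = 1 := by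
    rw [he, smul_mul_smul_comm, inv_mul_cancel₀ hl0, one_smul, hs.tsum_pow_mul_one_sub]
  have hmem := spectrum.mem_resolventSet_of_left_right_inverse h1 h2
  refine ⟨hmem, fun n => ?_⟩
  have hR : resolvent a l = l⁻¹ • ∑' i : ℕ, (l⁻¹ • a) ^ i := by
    calc resolvent a l = resolvent a l * ((algebraMap ℂ A l - a) *
          (l⁻¹ • ∑' i : ℕ, (l⁻¹ • a) ^ i)) := by rw [h1, mul_one]
      _ = _ := by rw [← mul_assoc, resolvent_mul_sub_algebraMap hmem, one_mul]
  have hsum : ‖∑' i : ℕ, a ^ n * (l⁻¹ • a) ^ i‖ ≤ (1 - ‖l‖⁻¹)⁻¹ * K := by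
    refine tsum_of_norm_bounded ?_ fun i => hb i n
    exact (hasSum_geometric_of_lt_one (by positivity) hq).mul_right K
  rw [hR, mul_smul_comm, norm_smul, norm_inv, ← hs.tsum_mul_left]
  calc ‖l‖⁻¹ * ‖∑' i : ℕ, a ^ n * (l⁻¹ • a) ^ i‖ ≤ ‖l‖⁻¹ * ((1 - ‖l‖⁻¹)⁻¹ * K) := by gcongr
    _ = K / (‖l‖ - 1) := by
      have : ‖l‖ - 1 ≠ 0 := by linarith
      have : 1 - ‖l‖⁻¹ ≠ 0 := by linarith
      field_simp

end Resolvent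

/-! ### The kernel and its size near its zeros and its pole. -/

section Kernel

/-- The rational function `-(l - w) (l - w⁻¹) / (l - 1)`, which vanishes at `w` and `w⁻¹` and
behaves like `1 - l` away from `1`. -/
noncomputable def newmanKernel (w l : ℂ) : ℂ :=
  -((l - w) * (l - w⁻¹) / (l - 1))

theorem newmanKernel_inv (w l : ℂ) : newmanKernel w⁻¹ l = newmanKernel w l := by
  simp only [newmanKernel, inv_inv]; ring

/-- This exhibits the kernel as `1 - l` with a correction whose coefficient is only `‖w - 1‖²` for
unimodular `w`. -/
theorem newmanKernel_eq {w l : ℂ} (hw : w ≠ 0) (hl : l ≠ 1) :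
    newmanKernel w l = 1 - l - (2 - w - w⁻¹) * (l / (l - 1)) := by
  have : l - 1 ≠ 0 := sub_ne_zero.2 hl
  unfold newmanKernel
  field_simp
  ring

theorem norm_inv_sub_one {w : ℂ} (hw : ‖w‖ = 1) : ‖w⁻¹ - 1‖ = ‖w - 1‖ := by
  have hw0 : w ≠ 0 := fun h => by simp [h] at hw
  have : w⁻¹ - 1 = -(w⁻¹ * (w - 1)) := by field_simp; ring
  rw [this, norm_neg, norm_mul, norm_inv, hw, inv_one, one_mul]

theorem norm_two_sub_sub_inv {w : ℂ} (hw : ‖w‖ = 1) : ‖2 - w - w⁻¹‖ = ‖w - 1‖ ^ 2 := by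
  have hw0 : w ≠ 0 := fun h => by simp [h] at hw
  have : 2 - w - w⁻¹ = -(w⁻¹ * (w - 1) ^ 2) := by field_simp; ring
  rw [this, norm_neg, norm_mul, norm_inv, hw, inv_one, one_mul, norm_pow]

/-- Radial projection moves `r w` by `|r - 1|`, which is at most its distance to `1`. -/
theorem norm_sub_one_le_two_mul {w : ℂ} (hw : ‖w‖ = 1) {r : ℝ} (hr : 0 ≤ r) :
    ‖w - 1‖ ≤ 2 * ‖r * w - 1‖ := by
  have h1 : ‖w - r * w‖ = |1 - r| := by
    rw [← one_sub_mul, norm_mul, hw, mul_one, ← Complex.ofReal_one, ← Complex.ofReal_sub,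
      Complex.norm_real, Real.norm_eq_abs]
  have h2 : |r - 1| ≤ ‖r * w - 1‖ := by
    have := abs_norm_sub_norm_le (r * w) 1
    rwa [norm_mul, hw, norm_one, Complex.norm_real, Real.norm_of_nonneg hr, mul_one] at this
  rw [abs_sub_comm] at h2
  have h3 := norm_sub_le_norm_sub_add_norm_sub w (r * w) 1
  linarith

theorem norm_newmanKernel_le {w l : ℂ} (hw : ‖w‖ = 1) (h : ‖w - 1‖ ≤ 2 * ‖l - 1‖) :
    ‖newmanKernel w l‖ ≤ 9 * ‖l - 1‖ := by
  rcases eq_or_ne l 1 with rfl | hl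
  · simp [newmanKernel]
  have hpos : 0 < ‖l - 1‖ := norm_pos_iff.2 (sub_ne_zero.2 hl)
  have h1 : ‖l - w‖ ≤ 3 * ‖l - 1‖ := by
    have := norm_sub_le_norm_sub_add_norm_sub l 1 w
    rw [norm_sub_rev 1 w] at this; linarith
  have h2 : ‖l - w⁻¹‖ ≤ 3 * ‖l - 1‖ := by
    have := norm_sub_le_norm_sub_add_norm_sub l 1 w⁻¹
    rw [norm_sub_rev 1 w⁻¹, norm_inv_sub_one hw] at this; linarith
  rw [newmanKernel, norm_neg, norm_div, norm_mul, div_le_iff₀ hpos]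
  calc ‖l - w‖ * ‖l - w⁻¹‖ ≤ (3 * ‖l - 1‖) * (3 * ‖l - 1‖) := by gcongr
    _ = _ := by ring

/-- On the ray through `w` the factor `l - w` has modulus `|r - 1|`, and the other factor cancels
the pole up to the constant 3. -/
theorem norm_newmanKernel_mul_le {w : ℂ} (hw : ‖w‖ = 1) {r : ℝ} (hr : 0 ≤ r) :
    ‖newmanKernel w (r * w)‖ ≤ 3 * |r - 1| := by
  rcases eq_or_ne (r * w : ℂ) 1 with hl | hl
  · simp [newmanKernel, hl]
  have hpos : 0 < ‖r * w - 1‖ := norm_pos_iff.2 (sub_ne_zero.2 hl)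
  have h1 : ‖r * w - w‖ = |r - 1| := by
    rw [← sub_one_mul, norm_mul, hw, mul_one, ← Complex.ofReal_one, ← Complex.ofReal_sub,
      Complex.norm_real, Real.norm_eq_abs]
  have h2 : ‖r * w - w⁻¹‖ ≤ 3 * ‖r * w - 1‖ := by
    have := norm_sub_le_norm_sub_add_norm_sub (r * w) 1 w⁻¹
    rw [norm_sub_rev 1 w⁻¹, norm_inv_sub_one hw] at this
    linarith [norm_sub_one_le_two_mul hw hr]
  rw [newmanKernel, norm_neg, norm_div, norm_mul, div_le_iff₀ hpos, h1]
  calc |r - 1| * ‖r * w - w⁻¹‖ ≤ |r - 1| * (3 * ‖r * w - 1‖) := by gcongr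
    _ = _ := by ring

end Kernel

/-! ### Cauchy's theorem for periodic functions in the coordinate `l = e^z`. -/

section Strip

open Complex

variable {E : Type*} [NormedAddCommGroup E] [NormedSpace ℂ E]

theorem intervalIntegrable_vertical {f : ℂ → E} {S : Set ℂ} (hf : DifferentiableOn ℂ f S)
    {x c d : ℝ} (h : ∀ y ∈ uIcc c d, (x + y * I : ℂ) ∈ S) :
    IntervalIntegrable (fun y : ℝ => f (x + y * I)) MeasureTheory.volume c d :=
  (hf.continuousOn.comp (by fun_prop) h).intervalIntegrable

theorem intervalIntegrable_horizontal {f : ℂ → E} {S : Set ℂ} (hf : DifferentiableOn ℂ f S)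
    {y c d : ℝ} (h : ∀ x ∈ uIcc c d, (x + y * I : ℂ) ∈ S) :
    IntervalIntegrable (fun x : ℝ => f (x + y * I)) MeasureTheory.volume c d :=
  (hf.continuousOn.comp (by fun_prop) h).intervalIntegrable

theorem vertical_integral_sub_eq {f : ℂ → E} {x₁ x₂ c d : ℝ}
    (hf : DifferentiableOn ℂ f (uIcc x₁ x₂ ×ℂ uIcc c d)) :
    (∫ y in c..d, f (x₂ + y * I)) - ∫ y in c..d, f (x₁ + y * I) =
      I • ((∫ x in x₁..x₂, f (x + c * I)) - ∫ x in x₁..x₂, f (x + d * I)) := by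
  have h := Complex.integral_boundary_rect_eq_zero_of_differentiableOn f ⟨x₁, c⟩ ⟨x₂, d⟩ hf
  simp only at h
  rw [add_sub_assoc, ← smul_sub, add_eq_zero_iff_eq_neg] at h
  rw [h, smul_neg, smul_smul, I_mul_I, neg_one_smul, neg_neg]

/-- The two horizontal sides of the rectangle cancel by periodicity. -/
theorem vertical_integral_period_eq {f : ℂ → E} (hper : Function.Periodic f (2 * Real.pi * I))
    {x₁ x₂ : ℝ} (hf : DifferentiableOn ℂ f (re ⁻¹' uIcc x₁ x₂)) (b : ℝ) :
    ∫ y in b..b + 2 * Real.pi, f (x₂ + y * I) = ∫ y in b..b + 2 * Real.pi, f (x₁ + y * I) := by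
  have h := vertical_integral_sub_eq (c := b) (d := b + 2 * Real.pi)
    (hf.mono (fun z hz => hz.1))
  have he : ∀ x : ℝ, f (x + ((b + 2 * Real.pi : ℝ) : ℂ) * I) = f (x + b * I) := fun x => by
    rw [← hper (x + b * I)]; congr 1; push_cast; ring
  simp only [he, sub_self, smul_zero] at h
  exact sub_eq_zero.1 h

variable [CompleteSpace E]

/-- Shifting the line of integration of a periodic holomorphic function to infinity. -/
theorem vertical_integral_period_of_tendsto {f : ℂ → E}
    (hper : Function.Periodic f (2 * Real.pi * I)) {x₀ : ℝ} {l : Filter ℝ} [l.NeBot] {L : E}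
    (hf : ∀ᶠ x in l, DifferentiableOn ℂ f (re ⁻¹' uIcc x₀ x))
    (hL : Tendsto f (comap re l) (nhds L)) (b : ℝ) :
    ∫ y in b..b + 2 * Real.pi, f (x₀ + y * I) = (2 * Real.pi) • L := by
  rw [← sub_eq_zero, ← norm_le_zero_iff]
  refine le_of_forall_pos_le_add fun η hη => ?_
  have hη' : 0 < η / (2 * Real.pi) := by positivity
  have h1 := (Metric.tendsto_nhds.1 hL _ hη')
  rw [eventually_comap] at h1
  obtain ⟨x, hx, hd⟩ := (h1.and hf).exists
  have hi : IntervalIntegrable (fun y : ℝ => f (x + y * I)) MeasureTheory.volume b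
      (b + 2 * Real.pi) := intervalIntegrable_vertical hd fun y _ => by simp
  rw [← vertical_integral_period_eq hper hd b]
  have hc : (2 * Real.pi) • L = ∫ y in b..b + 2 * Real.pi, L := by simp
  rw [hc, ← intervalIntegral.integral_sub hi (by simp)]
  refine (intervalIntegral.norm_integral_le_of_norm_le_const (C := η / (2 * Real.pi))
    fun y _ => ?_).trans (le_of_eq ?_)
  · rw [← dist_eq_norm]
    exact (hx _ (by simp)).le
  · rw [add_sub_cancel_left, abs_of_pos (by positivity)]
    field_simp
    ring

end Strip

/-! ### Full-circle integrals, evaluated at infinity and at zero. -/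

section Contour

open Complex

variable {A : Type*} [NormedRing A] [NormedAlgebra ℂ A] {a : A}

theorem differentiable_sum_exp_pow (a : A) (n : ℕ) :
    Differentiable ℂ fun z => ∑ i ∈ Finset.range n, exp z ^ i • a ^ (n - 1 - i) := by
  fun_prop

variable [CompleteSpace A]

theorem differentiableAt_resolvent_exp {z : ℂ} (hz : exp z ∈ resolventSet ℂ a) :
    DifferentiableAt ℂ (fun z => resolvent a (exp z)) z :=
  (spectrum.hasDerivAt_resolvent_const_left hz).differentiableAt.comp z
    differentiableAt_exp

theorem differentiableAt_newmanKernel_exp {w z : ℂ} (hz : exp z ≠ 1) :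
    DifferentiableAt ℂ (fun z => newmanKernel w (exp z) * exp z) z := by
  have : exp z - 1 ≠ 0 := sub_ne_zero.2 hz
  unfold newmanKernel
  fun_prop (disch := assumption)

theorem exp_ne_one_of_re_ne_zero {z : ℂ} (hz : z.re ≠ 0) : exp z ≠ 1 := fun h => by
  have := congrArg norm h
  rw [norm_exp, norm_one, Real.exp_eq_one_iff] at this
  exact hz this

theorem periodic_comp_exp {E : Type*} (f : ℂ → E) :
    Function.Periodic (fun z => f (exp z)) (2 * Real.pi * I) := fun z => by
  simp only [exp_periodic z]

/-- The kernel grows like `-l` and `l R(l)` tends to `1`, so adding `l • 1` removes the divergence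
and leaves the finite coefficient. -/
theorem tendsto_newmanKernel_smul_resolvent {w : ℂ} (hw : w ≠ 0) {a : A} :
    Tendsto (fun l : ℂ => (newmanKernel w l * l) • resolvent a l + l • (1 : A))
      (Bornology.cobounded ℂ) (nhds ((1 - (2 - w - w⁻¹)) • (1 : A) - a)) := by
  have hR : Tendsto (resolvent a) (Bornology.cobounded ℂ) (nhds 0) :=
    spectrum.resolvent_tendsto_cobounded a
  have hi : Tendsto (fun l : ℂ => l⁻¹) (Bornology.cobounded ℂ) (nhds 0) :=
    tendsto_inv₀_cobounded
  have hi1 : Tendsto (fun l : ℂ => (l - 1)⁻¹) (Bornology.cobounded ℂ) (nhds 0) :=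
    hi.comp (tendsto_sub_const_cobounded 1)
  have hlim : Tendsto (fun l : ℂ => (1 - (2 - w - w⁻¹) * (1 + (l - 1)⁻¹)) • (1 : A) +
      (l⁻¹ - 1 - (2 - w - w⁻¹) * (l - 1)⁻¹) • (a * (1 + a * resolvent a l)))
      (Bornology.cobounded ℂ)
      (nhds ((1 - (2 - w - w⁻¹) * (1 + 0)) • (1 : A) +
        ((0 : ℂ) - 1 - (2 - w - w⁻¹) * 0) • (a * (1 + a * 0)))) := by
    refine Tendsto.add (Tendsto.smul_const ?_ _) (Tendsto.smul ?_ ?_)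
    · exact tendsto_const_nhds.sub (tendsto_const_nhds.mul (tendsto_const_nhds.add hi1))
    · exact (hi.sub tendsto_const_nhds).sub (tendsto_const_nhds.mul hi1)
    · exact tendsto_const_nhds.mul (tendsto_const_nhds.add (tendsto_const_nhds.mul hR))
  have hval : (1 - (2 - w - w⁻¹) * (1 + 0)) • (1 : A) +
        ((0 : ℂ) - 1 - (2 - w - w⁻¹) * 0) • (a * (1 + a * 0)) =
      (1 - (2 - w - w⁻¹)) • (1 : A) - a := by
    simp [sub_eq_add_neg]
  rw [hval] at hlim
  refine hlim.congr' ?_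
  have hbig : ∀ᶠ l : ℂ in Bornology.cobounded ℂ, max 1 (‖a‖ * ‖(1 : A)‖) < ‖l‖ :=
    tendsto_norm_cobounded_atTop.eventually_gt_atTop _
  filter_upwards [hbig] with l hl
  have hl1 : 1 < ‖l‖ := (le_max_left _ _).trans_lt hl
  have hl0 : l ≠ 0 := fun h => by norm_num [h] at hl1
  have hln : l ≠ 1 := fun h => by norm_num [h] at hl1
  have hln' : l - 1 ≠ 0 := sub_ne_zero.2 hln
  have hmem : l ∈ resolventSet ℂ a :=
    spectrum.mem_resolventSet_of_norm_lt_mul ((le_max_right _ _).trans_lt hl)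
  have h1 : l⁻¹ - 1 - (2 - w - w⁻¹) * (l - 1)⁻¹ = newmanKernel w l * l⁻¹ := by
    rw [newmanKernel_eq hw hln]; field_simp
  have h2 : 1 - (2 - w - w⁻¹) * (1 + (l - 1)⁻¹) = newmanKernel w l + l := by
    rw [newmanKernel_eq hw hln]; field_simp; ring
  rw [h1, h2, ← smul_resolvent_eq hmem, mul_smul_comm, smul_smul, mul_assoc,
    inv_mul_cancel₀ hl0, mul_one, mul_smul, smul_resolvent_eq hmem, smul_add, add_smul]
  abel

/-- The compensating term `e^z • 1` has zero mean over a period, so the limit at infinity is the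
value of the integral. The factor `e^z` comes from `dl = i e^z dy`. -/
theorem integral_newmanKernel_smul_resolvent {K : ℝ} (hK : ∀ n : ℕ, ‖a ^ n‖ ≤ K) {w : ℂ}
    (hw : w ≠ 0) {x : ℝ} (hx : 0 < x) (b : ℝ) :
    ∫ y in b..b + 2 * Real.pi, (newmanKernel w (exp (x + y * I)) * exp (x + y * I)) •
        resolvent a (exp (x + y * I)) =
      (2 * Real.pi) • ((1 - (2 - w - w⁻¹)) • (1 : A) - a) := by
  have hd1 : DifferentiableOn ℂ (fun z => (newmanKernel w (exp z) * exp z) •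
      resolvent a (exp z)) {z | 0 < z.re} := fun z hz => by
    have hz' : 1 < ‖exp z‖ := by rw [norm_exp]; exact Real.one_lt_exp_iff.2 hz
    exact ((differentiableAt_newmanKernel_exp (exp_ne_one_of_re_ne_zero (ne_of_gt hz))).smul
      (differentiableAt_resolvent_exp
        (mem_resolventSet_and_norm_pow_mul_resolvent_le hK hz').1)).differentiableWithinAt
  have hd2 : Differentiable ℂ (fun z => exp z • (1 : A)) :=
    differentiable_exp.smul_const _
  have e2 : ∫ y in b..b + 2 * Real.pi, exp (x + y * I) • (1 : A) = 0 := by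
    have := vertical_integral_period_of_tendsto (f := fun z => exp z • (1 : A)) (x₀ := x)
      (l := atBot) (L := 0) (periodic_comp_exp (fun l => l • (1 : A)))
      (Eventually.of_forall fun _ => hd2.differentiableOn) (by
        have h := (tendsto_exp_comap_re_atBot.smul_const (1 : A))
        simpa using h) b
    simpa using this
  have e1 := vertical_integral_period_of_tendsto
    (f := fun z => (newmanKernel w (exp z) * exp z) • resolvent a (exp z) + exp z • (1 : A))
    (x₀ := x) (l := atTop) (L := (1 - (2 - w - w⁻¹)) • (1 : A) - a)
    (periodic_comp_exp (fun l => (newmanKernel w l * l) • resolvent a l + l • (1 : A)))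
    (by
      filter_upwards [eventually_ge_atTop x] with x' hx'
      refine (hd1.mono fun z hz => ?_).add hd2.differentiableOn
      rw [uIcc_of_le hx'] at hz
      exact hx.trans_le hz.1)
    ((tendsto_newmanKernel_smul_resolvent hw).comp tendsto_exp_comap_re_atTop) b
  rw [intervalIntegral.integral_add, e2, add_zero] at e1
  · exact e1
  · exact intervalIntegrable_vertical (f := fun z => (newmanKernel w (exp z) * exp z) •
      resolvent a (exp z)) hd1 fun y _ => by simpa using hx
  · exact intervalIntegrable_vertical (f := fun z => exp z • (1 : A))
      (hd2.differentiableOn (s := univ)) fun y _ => mem_univ _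

/-- The only pole, at `1`, lies outside the circle; the circle shrinks to `0`, where the factor `l`
vanishes. -/
theorem integral_newmanKernel_smul_sum {w : ℂ} (n : ℕ) {x : ℝ} (hx : x < 0) (b : ℝ) :
    ∫ y in b..b + 2 * Real.pi, (newmanKernel w (exp (x + y * I)) * exp (x + y * I)) •
        ∑ i ∈ Finset.range n, exp (x + y * I) ^ i • a ^ (n - 1 - i) = 0 := by
  have := vertical_integral_period_of_tendsto
    (f := fun z => (newmanKernel w (exp z) * exp z) •
      ∑ i ∈ Finset.range n, exp z ^ i • a ^ (n - 1 - i))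
    (x₀ := x) (l := atBot) (L := 0)
    (periodic_comp_exp (fun l => (newmanKernel w l * l) •
      ∑ i ∈ Finset.range n, l ^ i • a ^ (n - 1 - i)))
    (by
      filter_upwards [eventually_le_atBot x] with x' hx'
      intro z hz
      rw [uIcc_of_ge hx'] at hz
      have hz0 : z.re ≠ 0 := ne_of_lt (lt_of_le_of_lt hz.2 hx)
      exact ((differentiableAt_newmanKernel_exp (exp_ne_one_of_re_ne_zero hz0)).smul
        (differentiable_sum_exp_pow a n z)).differentiableWithinAt)
    (by
      have hc : ContinuousAt (fun l : ℂ => (newmanKernel w l * l) •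
          ∑ i ∈ Finset.range n, l ^ i • a ^ (n - 1 - i)) 0 := by
        have : (0 : ℂ) - 1 ≠ 0 := by norm_num
        unfold newmanKernel
        fun_prop (disch := assumption)
      have h := hc.tendsto.comp tendsto_exp_comap_re_atBot
      simpa [Function.comp_def] using h) b
  simpa using this

end Contour

/-! ### Bounds for the individual pieces of the contour. -/

section Estimate

open Complex

theorem norm_exp_ofReal_mul_I_sub_one (y : ℝ) : ‖exp (y * I) - 1‖ = 2 * |Real.sin (y / 2)| := by
  rw [mul_comm, norm_exp_I_mul_ofReal_sub_one, norm_mul, Real.norm_eq_abs, Real.norm_eq_abs,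
    abs_two]

theorem norm_exp_ofReal_mul_I_sub_one_le (y : ℝ) : ‖exp (y * I) - 1‖ ≤ |y| := by
  rw [mul_comm]; exact Real.norm_exp_I_mul_ofReal_sub_one_le

theorem norm_exp_sub_one_mono {ε y : ℝ} (hε : 0 ≤ ε) (hy : y ∈ Icc ε (2 * Real.pi - ε)) :
    ‖exp (ε * I) - 1‖ ≤ ‖exp (y * I) - 1‖ := by
  have hεπ : ε ≤ Real.pi := by linarith [hy.1, hy.2]
  have hs : 0 ≤ Real.sin (ε / 2) :=
    Real.sin_nonneg_of_nonneg_of_le_pi (by linarith) (by linarith)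
  rw [norm_exp_ofReal_mul_I_sub_one, norm_exp_ofReal_mul_I_sub_one, abs_of_nonneg hs]
  refine mul_le_mul_of_nonneg_left ?_ zero_le_two
  refine le_trans ?_ (le_abs_self _)
  rcases le_total y Real.pi with h | h
  · exact Real.sin_le_sin_of_le_of_le_pi_div_two (by linarith) (by linarith) (by linarith [hy.1])
  · rw [← Real.sin_pi_sub (y / 2)]
    exact Real.sin_le_sin_of_le_of_le_pi_div_two (by linarith) (by linarith) (by linarith [hy.2])

theorem exp_ofReal_add_ofReal_mul_I (x y : ℝ) :
    exp (x + y * I) = (Real.exp x : ℂ) * exp (y * I) := by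
  rw [exp_add, ofReal_exp]

theorem norm_exp_ofReal_add_ofReal_mul_I (x y : ℝ) : ‖exp (x + y * I)‖ = Real.exp x := by
  simp [norm_exp]

variable {A : Type*} [NormedRing A] [NormedAlgebra ℂ A] {a : A}

/-- Bound on the back part of the contour, away from `1`. -/
theorem norm_newmanKernel_exp_le {ε x y : ℝ} (hε : 0 ≤ ε) (hx : x ≤ 0)
    (hy : y ∈ Icc ε (2 * Real.pi - ε)) :
    ‖newmanKernel (exp (ε * I)) (exp (x + y * I)) * exp (x + y * I)‖ ≤ 18 := by
  have hex : Real.exp x ≤ 1 := Real.exp_le_one_iff.2 hx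
  have h1 : ‖exp (ε * I) - 1‖ ≤ 2 * ‖exp (x + y * I) - 1‖ := by
    rw [exp_ofReal_add_ofReal_mul_I]
    exact (norm_exp_sub_one_mono hε hy).trans
      (norm_sub_one_le_two_mul (norm_exp_ofReal_mul_I y) (Real.exp_pos x).le)
  have h2 := norm_newmanKernel_le (norm_exp_ofReal_mul_I ε) h1
  have h3 : ‖exp (x + y * I) - 1‖ ≤ 2 := by
    have := norm_sub_le (exp (x + y * I)) 1
    rw [norm_exp_ofReal_add_ofReal_mul_I, norm_one] at this
    linarith
  rw [norm_mul, norm_exp_ofReal_add_ofReal_mul_I]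
  calc _ ≤ (18 : ℝ) * 1 := by
        gcongr
        linarith
    _ = 18 := mul_one _

/-- Bound on the vertical parts of the contour, near `1`. -/
theorem norm_newmanKernel_exp_le_of_abs_eq {ε x y : ℝ} (hε : 0 ≤ ε) (hε' : ε ≤ 1 / 2)
    (hx : |x| = ε) (hy : |y| ≤ ε) :
    ‖newmanKernel (exp (ε * I)) (exp (x + y * I)) * exp (x + y * I)‖ ≤ 72 * ε := by
  have hlow : |x| ≤ 2 * ‖exp (x + y * I) - 1‖ := by
    have h := abs_norm_sub_norm_le (exp (x + y * I)) 1
    rw [norm_exp_ofReal_add_ofReal_mul_I, norm_one] at h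
    refine le_trans ?_ (mul_le_mul_of_nonneg_left h zero_le_two)
    rcases le_total 0 x with h0 | h0
    · have := Real.add_one_le_exp x
      rw [abs_of_nonneg h0, abs_of_nonneg (by linarith)]
      linarith
    · rw [abs_of_nonpos h0] at hx ⊢
      have h1 : Real.exp x ≤ (1 - x)⁻¹ := by
        have := Real.add_one_le_exp (-x)
        rw [← inv_inv (Real.exp x), ← Real.exp_neg]
        gcongr
        · linarith
        · linarith
      -- Equivalent to `x (1 + x) ≤ 0`, true as `-1 ≤ x ≤ 0`.
      have h2 : (1 - x)⁻¹ ≤ 1 + x / 2 := by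
        rw [inv_le_iff_one_le_mul₀ (by linarith)]
        nlinarith
      rw [abs_of_nonpos (by linarith)]
      linarith
  have h1 : ‖exp (ε * I) - 1‖ ≤ 2 * ‖exp (x + y * I) - 1‖ := by
    refine (norm_exp_ofReal_mul_I_sub_one_le ε).trans ?_
    rwa [abs_of_nonneg hε, ← hx]
  have h2 := norm_newmanKernel_le (norm_exp_ofReal_mul_I ε) h1
  have hz : ‖(x + y * I : ℂ)‖ ≤ 2 * ε := by
    refine (norm_add_le _ _).trans ?_
    rw [norm_mul, norm_real, norm_real, norm_I, Real.norm_eq_abs, Real.norm_eq_abs]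
    linarith
  -- As `‖z‖ ≤ 2ε ≤ 1`, this gives `‖e^z - 1‖ ≤ 4ε`; then `9 · 4ε` times `e^x ≤ 2` is `72ε`.
  have h3 := norm_exp_sub_one_le (hz.trans (by linarith))
  have hex : Real.exp x ≤ 2 := by
    have hx2 : x ≤ 1 / 2 := (le_abs_self x).trans (hx.le.trans hε')
    have h4 : Real.exp (1 / 2) * Real.exp (1 / 2) < 4 := by
      rw [← Real.exp_add]; norm_num; linarith [Real.exp_one_lt_d9]
    have h5 := Real.exp_le_exp.2 hx2
    nlinarith [Real.exp_pos (1 / 2)]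
  rw [norm_mul, norm_exp_ofReal_add_ofReal_mul_I]
  calc _ ≤ (36 * ε) * 2 := by
        gcongr
        linarith
    _ = 72 * ε := by ring

/-- Bound on the horizontal parts of the contour, which end at a zero of the kernel. -/
theorem norm_newmanKernel_exp_horizontal_le {w : ℂ} (hw : ‖w‖ = 1) (x y : ℝ)
    (hy : w = exp (y * I) ∨ w = (exp (y * I))⁻¹) :
    ‖newmanKernel w (exp (x + y * I)) * exp (x + y * I)‖ ≤
      3 * |Real.exp x - 1| * Real.exp x := by
  rw [norm_mul, norm_exp_ofReal_add_ofReal_mul_I, exp_ofReal_add_ofReal_mul_I]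
  gcongr
  rcases hy with rfl | rfl
  · exact norm_newmanKernel_mul_le hw (Real.exp_pos x).le
  · rw [newmanKernel_inv]
    exact norm_newmanKernel_mul_le (norm_exp_ofReal_mul_I y) (Real.exp_pos x).le

theorem norm_integral_horizontal_sum_le {K : ℝ} (hK : ∀ n : ℕ, ‖a ^ n‖ ≤ K) {w : ℂ}
    (hw : ‖w‖ = 1) {ε y : ℝ} (hε : 0 ≤ ε)
    (hy : w = exp (y * I) ∨ w = (exp (y * I))⁻¹) (n : ℕ) :
    ‖∫ x in (-ε)..(0 : ℝ), (newmanKernel w (exp (x + y * I)) * exp (x + y * I)) •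
      ∑ i ∈ Finset.range n, exp (x + y * I) ^ i • a ^ (n - 1 - i)‖ ≤ 3 * K * ε := by
  have hK0 : 0 ≤ K := (norm_nonneg _).trans (hK 0)
  refine (intervalIntegral.norm_integral_le_of_norm_le_const (C := 3 * K) fun x hx => ?_).trans
    (by rw [sub_neg_eq_add, zero_add, abs_of_nonneg hε])
  rw [uIoc_of_le (by linarith)] at hx
  have h2 := norm_newmanKernel_exp_horizontal_le hw x y hy
  rw [norm_smul]
  -- At `x = 0` the geometric bound is unavailable, but the kernel vanishes there.
  rcases hx.2.eq_or_lt with rfl | hx0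
  · have h0 : ‖newmanKernel w (exp ((0 : ℝ) + y * I)) * exp ((0 : ℝ) + y * I)‖ = 0 :=
      le_antisymm (by simpa using h2) (norm_nonneg _)
    rw [h0, zero_mul]; positivity
  have hpos : 0 < 1 - Real.exp x := sub_pos.2 (Real.exp_zero ▸ Real.exp_lt_exp.2 hx0)
  have hl : ‖exp (x + y * I)‖ < 1 := by
    rw [norm_exp_ofReal_add_ofReal_mul_I]; linarith
  have h1 := norm_sum_pow_smul_pow_le hK n hl
  rw [norm_exp_ofReal_add_ofReal_mul_I] at h1
  rw [abs_of_neg (by linarith)] at h2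
  calc _ ≤ (3 * -(Real.exp x - 1) * Real.exp x) * (K / (1 - Real.exp x)) := by
        gcongr
        exact (norm_nonneg _).trans h2
    _ = 3 * K * Real.exp x := by field_simp; ring
    _ ≤ 3 * K * 1 := by gcongr; linarith
    _ = 3 * K := by ring

/-- The zero of the kernel contributes `-x`, and `u e^{-u} ≤ 1` with `u = -n x` turns it into the
gain `1/n`. -/
theorem norm_integral_horizontal_inner_le {B α : ℝ} (hα : 0 ≤ α) {w : ℂ} (hw : ‖w‖ = 1) {y : ℝ}
    (hy : w = exp (y * I) ∨ w = (exp (y * I))⁻¹)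
    (hB : ∀ x ∈ Icc (-α) 0, ‖resolvent a (exp (x + y * I))‖ ≤ B) {n : ℕ} (hn : 0 < n) :
    ‖∫ x in (-α)..(0 : ℝ), (newmanKernel w (exp (x + y * I)) * exp (x + y * I)) •
      (exp (x + y * I) ^ n • resolvent a (exp (x + y * I)))‖ ≤ 3 / n * B * α := by
  refine (intervalIntegral.norm_integral_le_of_norm_le_const (C := 3 / n * B)
    fun x hx => ?_).trans (by rw [sub_neg_eq_add, zero_add, abs_of_nonneg hα])
  rw [uIoc_of_le (by linarith)] at hx
  have hn' : (0 : ℝ) < n := by exact_mod_cast hn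
  have h1 := hB x ⟨hx.1.le, hx.2⟩
  have hB0 : 0 ≤ B := (norm_nonneg _).trans h1
  have h2 := norm_newmanKernel_exp_horizontal_le hw x y hy
  have hex : Real.exp x ≤ 1 := Real.exp_le_one_iff.2 hx.2
  rw [abs_of_nonpos (by linarith)] at h2
  have h3 : (-x) * Real.exp x ^ n ≤ 1 / n := by
    rw [le_div_iff₀ hn', ← Real.exp_nat_mul]
    have h4 := Real.add_one_le_exp (-(n * x))
    calc -x * Real.exp (n * x) * n = (-(n * x)) * Real.exp (n * x) := by ring
      _ ≤ Real.exp (-(n * x)) * Real.exp (n * x) := by gcongr; linarith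
      _ = 1 := by rw [← Real.exp_add]; simp
  rw [norm_smul, norm_smul, norm_pow, norm_exp_ofReal_add_ofReal_mul_I]
  calc _ ≤ (3 * -(Real.exp x - 1) * Real.exp x) * (Real.exp x ^ n * B) := by
        gcongr
        exact (norm_nonneg _).trans h2
    _ ≤ (3 * -x * 1) * (Real.exp x ^ n * B) := by
        gcongr
        · linarith [hx.2]
        · linarith [Real.add_one_le_exp x]
    _ = 3 * (-x * Real.exp x ^ n) * B := by ring
    _ ≤ 3 * (1 / n) * B := by gcongr
    _ = 3 / n * B := by ring

/-- The kernel is `O(ε)` and the polynomial `O(1/ε)`, so the integrand is bounded on an interval of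
length `2ε`. -/
theorem norm_integral_vertical_sum_le {K : ℝ} (hK : ∀ n : ℕ, ‖a ^ n‖ ≤ K) {ε : ℝ}
    (hε : 0 < ε) (hε' : ε ≤ 1 / 2) (n : ℕ) :
    ‖∫ y in (-ε)..ε, (newmanKernel (exp (ε * I)) (exp ((-ε : ℝ) + y * I)) *
      exp ((-ε : ℝ) + y * I)) •
      ∑ i ∈ Finset.range n, exp ((-ε : ℝ) + y * I) ^ i • a ^ (n - 1 - i)‖ ≤ 288 * K * ε := by
  have hK0 : 0 ≤ K := (norm_nonneg _).trans (hK 0)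
  refine (intervalIntegral.norm_integral_le_of_norm_le_const (C := 144 * K)
    fun y hy => ?_).trans
    (by rw [sub_neg_eq_add, abs_of_nonneg (by linarith)]; linarith)
  rw [uIoc_of_le (by linarith)] at hy
  have hpos : ε / 2 ≤ 1 - Real.exp (-ε) := by
    have h1 : Real.exp (-ε) ≤ (1 + ε)⁻¹ := by
      rw [Real.exp_neg]
      gcongr
      linarith [Real.add_one_le_exp ε]
    have h2 : (1 + ε)⁻¹ ≤ 1 - ε / 2 := by
      rw [inv_le_iff_one_le_mul₀ (by linarith)]
      nlinarith
    linarith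
  have hl : ‖exp ((-ε : ℝ) + y * I)‖ < 1 := by
    rw [norm_exp_ofReal_add_ofReal_mul_I]; linarith
  have h1 := norm_sum_pow_smul_pow_le hK n hl
  rw [norm_exp_ofReal_add_ofReal_mul_I] at h1
  have h2 := norm_newmanKernel_exp_le_of_abs_eq (x := -ε) hε.le hε'
    (by rw [abs_neg, abs_of_pos hε]) (abs_le.2 ⟨hy.1.le, hy.2⟩)
  rw [norm_smul]
  calc _ ≤ (72 * ε) * (K / (1 - Real.exp (-ε))) := by gcongr
    _ ≤ (72 * ε) * (K / (ε / 2)) := by gcongr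
    _ = 144 * K := by field_simp; ring

/-- The decay is `|l|^n = e^{-nα}` on the shifted line; the constant is `18 · 2π`. -/
theorem norm_integral_vertical_inner_le {B α ε : ℝ} (hα : 0 ≤ α) (hε : 0 ≤ ε)
    (hε' : ε ≤ 1 / 2)
    (hB : ∀ y ∈ Icc ε (2 * Real.pi - ε), ‖resolvent a (exp ((-α : ℝ) + y * I))‖ ≤ B) (n : ℕ) :
    ‖∫ y in ε..(2 * Real.pi - ε), (newmanKernel (exp (ε * I)) (exp ((-α : ℝ) + y * I)) *
      exp ((-α : ℝ) + y * I)) •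
      (exp ((-α : ℝ) + y * I) ^ n • resolvent a (exp ((-α : ℝ) + y * I)))‖ ≤
        36 * Real.pi * B * Real.exp (-(n * α)) := by
  have hle : ε ≤ 2 * Real.pi - ε := by linarith [Real.pi_gt_three]
  have hB0 : 0 ≤ B := (norm_nonneg _).trans (hB ε ⟨le_rfl, hle⟩)
  refine (intervalIntegral.norm_integral_le_of_norm_le_const
    (C := 18 * (Real.exp (-(n * α)) * B)) fun y hy => ?_).trans ?_
  · rw [uIoc_of_le hle] at hy
    have hy' : y ∈ Icc ε (2 * Real.pi - ε) := ⟨hy.1.le, hy.2⟩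
    have h2 := norm_newmanKernel_exp_le hε (neg_nonpos.2 hα) hy'
    have h1 := hB y hy'
    rw [norm_smul, norm_smul, norm_pow, norm_exp_ofReal_add_ofReal_mul_I, ← Real.exp_nat_mul,
      mul_neg]
    gcongr
  · rw [abs_of_nonneg (by linarith)]
    calc 18 * (Real.exp (-(n * α)) * B) * (2 * Real.pi - ε - ε)
        ≤ 18 * (Real.exp (-(n * α)) * B) * (2 * Real.pi) := by gcongr; linarith
      _ = _ := by ring

variable [CompleteSpace A]

theorem norm_integral_horizontal_outer_le {K : ℝ} (hK : ∀ n : ℕ, ‖a ^ n‖ ≤ K) {w : ℂ}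
    (hw : ‖w‖ = 1) {ε y : ℝ} (hε : 0 ≤ ε) (hε' : ε ≤ 1 / 2)
    (hy : w = exp (y * I) ∨ w = (exp (y * I))⁻¹) (n : ℕ) :
    ‖∫ x in (0 : ℝ)..ε, (newmanKernel w (exp (x + y * I)) * exp (x + y * I)) •
      (a ^ n * resolvent a (exp (x + y * I)))‖ ≤ 6 * K * ε := by
  have hK0 : 0 ≤ K := (norm_nonneg _).trans (hK 0)
  refine (intervalIntegral.norm_integral_le_of_norm_le_const (C := 6 * K) fun x hx => ?_).trans
    (by rw [sub_zero, abs_of_nonneg hε])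
  rw [uIoc_of_le hε] at hx
  have hpos : 0 < Real.exp x - 1 := by linarith [Real.one_lt_exp_iff.2 hx.1]
  have hex : Real.exp x ≤ 2 := by
    have h4 : Real.exp (1 / 2) * Real.exp (1 / 2) < 4 := by
      rw [← Real.exp_add]; norm_num; linarith [Real.exp_one_lt_d9]
    have h5 := Real.exp_le_exp.2 (hx.2.trans hε')
    nlinarith [Real.exp_pos (1 / 2)]
  have hl : 1 < ‖exp (x + y * I)‖ := by
    rw [norm_exp_ofReal_add_ofReal_mul_I]; linarith
  have h1 := (mem_resolventSet_and_norm_pow_mul_resolvent_le hK hl).2 n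
  rw [norm_exp_ofReal_add_ofReal_mul_I] at h1
  have h2 := norm_newmanKernel_exp_horizontal_le hw x y hy
  rw [norm_smul]
  rw [abs_of_pos hpos] at h2
  calc _ ≤ (3 * (Real.exp x - 1) * Real.exp x) * (K / (Real.exp x - 1)) := by gcongr
    _ = 3 * K * Real.exp x := by field_simp
    _ ≤ 3 * K * 2 := by gcongr
    _ = 6 * K := by ring

theorem norm_integral_vertical_outer_le {K : ℝ} (hK : ∀ n : ℕ, ‖a ^ n‖ ≤ K) {ε : ℝ}
    (hε : 0 < ε) (hε' : ε ≤ 1 / 2) (n : ℕ) :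
    ‖∫ y in (-ε)..ε, (newmanKernel (exp (ε * I)) (exp (ε + y * I)) * exp (ε + y * I)) •
      (a ^ n * resolvent a (exp (ε + y * I)))‖ ≤ 144 * K * ε := by
  have hK0 : 0 ≤ K := (norm_nonneg _).trans (hK 0)
  refine (intervalIntegral.norm_integral_le_of_norm_le_const (C := 72 * K) fun y hy => ?_).trans
    (by rw [sub_neg_eq_add, abs_of_nonneg (by linarith)]; linarith)
  rw [uIoc_of_le (by linarith)] at hy
  have hpos : ε ≤ Real.exp ε - 1 := by linarith [Real.add_one_le_exp ε]
  have hl : 1 < ‖exp (ε + y * I)‖ := by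
    rw [norm_exp_ofReal_add_ofReal_mul_I]; linarith
  have h1 := (mem_resolventSet_and_norm_pow_mul_resolvent_le hK hl).2 n
  rw [norm_exp_ofReal_add_ofReal_mul_I] at h1
  have h2 := norm_newmanKernel_exp_le_of_abs_eq hε.le hε' (abs_of_pos hε)
    (abs_le.2 ⟨hy.1.le, hy.2⟩)
  rw [norm_smul]
  calc _ ≤ (72 * ε) * (K / (Real.exp ε - 1)) := by gcongr
    _ ≤ (72 * ε) * (K / ε) := by gcongr
    _ = 72 * K := by field_simp

end Estimate

/-! ### Assembly of the contour. -/

section PowerEstimate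

open Complex

variable {A : Type*} [NormedRing A] [NormedAlgebra ℂ A] [CompleteSpace A] {a : A}

/-- The contour integral estimate for the powers of a power-bounded element whose resolvent is
bounded by `B` on the region `exp (-α) ≤ |l| ≤ 1`, `ε ≤ arg l ≤ 2 π - ε`. -/
theorem norm_pow_mul_smul_one_sub_le {K : ℝ} (hK : ∀ n : ℕ, ‖a ^ n‖ ≤ K) {ε α B : ℝ}
    (hε : 0 < ε) (hε' : ε ≤ 1 / 2) (hα : 0 ≤ α)
    (hB : ∀ x ∈ Icc (-α) 0, ∀ y ∈ Icc ε (2 * Real.pi - ε),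
      exp (x + y * I) ∈ resolventSet ℂ a ∧ ‖resolvent a (exp (x + y * I))‖ ≤ B)
    {n : ℕ} (hn : 0 < n) :
    ‖a ^ n * ((1 - (2 - exp (ε * I) - (exp (ε * I))⁻¹)) • (1 : A) - a)‖ ≤
      450 * K * ε + 36 * Real.pi * B * Real.exp (-(n * α)) + 6 / n * B * α := by
  set w : ℂ := exp (ε * I) with hwdef
  have hw : ‖w‖ = 1 := norm_exp_ofReal_mul_I ε
  have hw0 : w ≠ 0 := exp_ne_zero _
  have hK0 : 0 ≤ K := (norm_nonneg _).trans (hK 0)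
  have hπ := Real.pi_gt_three
  have hle : ε ≤ 2 * Real.pi - ε := by linarith
  have hpole : ∀ x y : ℝ, y ∈ Icc ε (2 * Real.pi - ε) → exp (x + y * I) ≠ 1 := fun x y hy h => by
    have h1 := (norm_exp_sub_one_mono hε.le hy).trans
      (norm_sub_one_le_two_mul (norm_exp_ofReal_mul_I y) (Real.exp_pos x).le)
    rw [← exp_ofReal_add_ofReal_mul_I, h, sub_self, norm_zero, mul_zero,
      norm_exp_ofReal_mul_I_sub_one] at h1
    have : 0 < Real.sin (ε / 2) := Real.sin_pos_of_pos_of_lt_pi (by linarith) (by linarith)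
    have h2 := le_abs_self (Real.sin (ε / 2))
    linarith
  have hmem : ∀ x y : ℝ, -α ≤ x → y ∈ Icc ε (2 * Real.pi - ε) →
      exp (x + y * I) ∈ resolventSet ℂ a := fun x y hx hy => by
    rcases le_or_gt x 0 with h | h
    · exact (hB x ⟨hx, h⟩ y hy).1
    · refine (mem_resolventSet_and_norm_pow_mul_resolvent_le hK ?_).1
      rw [norm_exp_ofReal_add_ofReal_mul_I]
      exact Real.one_lt_exp_iff.2 h
  set q : ℂ → ℂ := fun z => newmanKernel w (exp z) * exp z with hq
  set Φ : ℂ → A := fun z => q z • (a ^ n * resolvent a (exp z)) with hΦ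
  set Ψ : ℂ → A := fun z => q z • (exp z ^ n • resolvent a (exp z)) with hΨ
  set P : ℂ → A := fun z => q z • ∑ i ∈ Finset.range n, exp z ^ i • a ^ (n - 1 - i) with hP
  have hsub : ∀ z, exp z ∈ resolventSet ℂ a → Φ z = Ψ z - P z := fun z hz => by
    simp only [hΦ, hΨ, hP, pow_mul_resolvent hz n, smul_sub]
  have dq : ∀ z, exp z ≠ 1 → DifferentiableAt ℂ q z := fun z hz =>
    differentiableAt_newmanKernel_exp hz
  have dΦ : DifferentiableOn ℂ Φ {z | exp z ≠ 1 ∧ exp z ∈ resolventSet ℂ a} := fun z hz =>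
    ((dq z hz.1).smul ((differentiableAt_resolvent_exp hz.2).const_mul
      (a ^ n))).differentiableWithinAt
  have dΨ : DifferentiableOn ℂ Ψ {z | exp z ≠ 1 ∧ exp z ∈ resolventSet ℂ a} := fun z hz =>
    ((dq z hz.1).smul ((differentiableAt_exp.pow n).smul
      (differentiableAt_resolvent_exp hz.2))).differentiableWithinAt
  have dP : DifferentiableOn ℂ P {z | exp z ≠ 1} := fun z hz =>
    ((dq z hz).smul (differentiable_sum_exp_pow a n z)).differentiableWithinAt
  have hεm : ∀ y : ℝ, exp (ε + y * I) ≠ 1 ∧ exp (ε + y * I) ∈ resolventSet ℂ a := fun y => by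
    have h1 : 1 < ‖exp (ε + y * I)‖ := by
      rw [norm_exp_ofReal_add_ofReal_mul_I]; exact Real.one_lt_exp_iff.2 hε
    exact ⟨exp_ne_one_of_re_ne_zero (by simpa using hε.ne'),
      (mem_resolventSet_and_norm_pow_mul_resolvent_le hK h1).1⟩
  -- vertical integrals
  have iΦ : ∀ c d : ℝ, IntervalIntegrable (fun y : ℝ => Φ (ε + y * I)) MeasureTheory.volume c d :=
    fun c d => intervalIntegrable_vertical dΦ fun y _ => hεm y
  have iΨ : ∀ c d : ℝ, IntervalIntegrable (fun y : ℝ => Ψ (ε + y * I)) MeasureTheory.volume c d :=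
    fun c d => intervalIntegrable_vertical dΨ fun y _ => hεm y
  have iP : ∀ c d : ℝ, IntervalIntegrable (fun y : ℝ => P (ε + y * I)) MeasureTheory.volume c d :=
    fun c d => intervalIntegrable_vertical dP fun y _ => (hεm y).1
  have iP' : ∀ c d : ℝ, IntervalIntegrable (fun y : ℝ => P ((-ε : ℝ) + y * I))
      MeasureTheory.volume c d :=
    fun c d => intervalIntegrable_vertical dP fun y _ =>
      exp_ne_one_of_re_ne_zero (by simpa using hε.ne')
  have hend : -ε + 2 * Real.pi = 2 * Real.pi - ε := by ring
  have e1 : (2 * Real.pi) • (a ^ n * ((1 - (2 - w - w⁻¹)) • (1 : A) - a)) =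
      (∫ y in (-ε)..ε, Φ (ε + y * I)) + ∫ y in ε..(2 * Real.pi - ε), Φ (ε + y * I) := by
    rw [intervalIntegral.integral_add_adjacent_intervals (iΦ _ _) (iΦ _ _), ← hend,
      ← mul_smul_comm, ← integral_newmanKernel_smul_resolvent hK hw0 hε (-ε)]
    have hi : IntervalIntegrable (fun y : ℝ => q (ε + y * I) • resolvent a (exp (ε + y * I)))
        MeasureTheory.volume (-ε) (-ε + 2 * Real.pi) :=
      intervalIntegrable_vertical
        (f := fun z => q z • resolvent a (exp z))
        (S := {z | exp z ≠ 1 ∧ exp z ∈ resolventSet ℂ a})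
        (fun z hz => ((dq z hz.1).smul
          (differentiableAt_resolvent_exp hz.2)).differentiableWithinAt) fun y _ => hεm y
    have := (ContinuousLinearMap.mul ℂ A (a ^ n)).intervalIntegral_comp_comm hi
    simp only [ContinuousLinearMap.mul_apply', mul_smul_comm] at this
    exact this.symm
  have e2 : ∫ y in ε..(2 * Real.pi - ε), Φ (ε + y * I) =
      (∫ y in ε..(2 * Real.pi - ε), Ψ (ε + y * I)) -
        ∫ y in ε..(2 * Real.pi - ε), P (ε + y * I) := by
    rw [← intervalIntegral.integral_sub (iΨ _ _) (iP _ _)]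
    exact intervalIntegral.integral_congr fun y _ => hsub _ (hεm y).2
  -- This trades the back integral of `P` at abscissa `-ε` for minus the front one, where the kernel
  -- is small.
  have e3 : (∫ y in (-ε)..ε, P ((-ε : ℝ) + y * I)) +
      ∫ y in ε..(2 * Real.pi - ε), P ((-ε : ℝ) + y * I) = 0 := by
    rw [intervalIntegral.integral_add_adjacent_intervals (iP' _ _) (iP' _ _), ← hend]
    exact integral_newmanKernel_smul_sum n (neg_lt_zero.2 hε) (-ε)
  have hrect : ∀ {x₁ x₂ : ℝ} {z : ℂ}, x₁ ≤ x₂ →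
      z ∈ uIcc x₁ x₂ ×ℂ uIcc ε (2 * Real.pi - ε) →
      z = (z.re : ℂ) + z.im * I ∧ x₁ ≤ z.re ∧ z.im ∈ Icc ε (2 * Real.pi - ε) :=
    fun h hz => by
      rw [uIcc_of_le h, uIcc_of_le hle] at hz
      exact ⟨(re_add_im _).symm, hz.1.1, hz.2⟩
  have e4 := vertical_integral_sub_eq (f := Ψ) (x₁ := -α) (x₂ := ε) (c := ε)
    (d := 2 * Real.pi - ε) (dΨ.mono fun z hz => by
      obtain ⟨h1, h2, h3⟩ := hrect (by linarith) hz
      rw [h1]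
      exact ⟨hpole _ _ h3, hmem _ _ h2 h3⟩)
  have e5 := vertical_integral_sub_eq (f := P) (x₁ := -ε) (x₂ := ε) (c := ε)
    (d := 2 * Real.pi - ε) (dP.mono fun z hz => by
      obtain ⟨h1, h2, h3⟩ := hrect (by linarith) hz
      rw [h1]
      exact hpole _ _ h3)
  -- horizontal integrals
  have e6 : ∀ y ∈ Icc ε (2 * Real.pi - ε),
      (∫ x in (-α)..ε, Ψ (x + y * I)) - ∫ x in (-ε)..ε, P (x + y * I) =
      (∫ x in (-α)..0, Ψ (x + y * I)) + (∫ x in (0 : ℝ)..ε, Φ (x + y * I)) -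
        ∫ x in (-ε)..0, P (x + y * I) := fun y hy => by
    have jΨ : ∀ c d : ℝ, -α ≤ c → c ≤ d →
        IntervalIntegrable (fun x : ℝ => Ψ (x + y * I)) MeasureTheory.volume c d :=
      fun c d hc hcd => intervalIntegrable_horizontal dΨ fun x hx => by
        rw [uIcc_of_le hcd] at hx
        exact ⟨hpole _ _ hy, hmem _ _ (hc.trans hx.1) hy⟩
    have jP : ∀ c d : ℝ,
        IntervalIntegrable (fun x : ℝ => P (x + y * I)) MeasureTheory.volume c d :=
      fun c d => intervalIntegrable_horizontal dP fun x _ => hpole _ _ hy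
    -- Outside the disc `Ψ` and `P` have no separate bounds uniform in `n`; only their difference
    -- `Φ` does, so they are recombined there.
    have h1 : ∫ x in (0 : ℝ)..ε, Φ (x + y * I) =
        (∫ x in (0 : ℝ)..ε, Ψ (x + y * I)) - ∫ x in (0 : ℝ)..ε, P (x + y * I) := by
      rw [← intervalIntegral.integral_sub (jΨ _ _ (by linarith) hε.le) (jP _ _)]
      refine intervalIntegral.integral_congr fun x hx => ?_
      rw [uIcc_of_le hε.le] at hx
      exact hsub _ (hmem _ _ (by linarith [hx.1]) hy)
    rw [h1, ← intervalIntegral.integral_add_adjacent_intervals (jΨ (-α) 0 le_rfl (by linarith))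
      (jΨ 0 ε (by linarith) hε.le),
      ← intervalIntegral.integral_add_adjacent_intervals (jP (-ε) 0) (jP 0 ε)]
    abel
  have b6 : ∀ y ∈ Icc ε (2 * Real.pi - ε), (w = exp (y * I) ∨ w = (exp (y * I))⁻¹) →
      ‖(∫ x in (-α)..ε, Ψ (x + y * I)) - ∫ x in (-ε)..ε, P (x + y * I)‖ ≤
        3 / n * B * α + 6 * K * ε + 3 * K * ε := fun y hy hwy => by
    rw [e6 y hy]
    refine (norm_sub_le _ _).trans (add_le_add ((norm_add_le _ _).trans (add_le_add ?_ ?_)) ?_)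
    · exact norm_integral_horizontal_inner_le hα hw hwy (fun x hx => (hB x hx y hy).2) hn
    · exact norm_integral_horizontal_outer_le hK hw hε.le hε' hwy n
    · exact norm_integral_horizontal_sum_le hK hw hε.le hwy n
  -- The upper edge meets the unit circle at the other zero `w⁻¹` of the kernel.
  have hw2 : w = (exp ((2 * Real.pi - ε : ℝ) * I))⁻¹ := by
    rw [hwdef, ← exp_neg, ← exp_periodic (-((2 * Real.pi - ε : ℝ) * I))]
    congr 1; push_cast; ring
  have b7 := b6 ε ⟨le_rfl, hle⟩ (Or.inl rfl)
  have b8 := b6 (2 * Real.pi - ε) ⟨hle, le_rfl⟩ (Or.inr hw2)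
  have b1 : ‖∫ y in (-ε)..ε, Φ (ε + y * I)‖ ≤ 144 * K * ε :=
    norm_integral_vertical_outer_le hK hε hε' n
  have b2 : ‖∫ y in (-ε)..ε, P ((-ε : ℝ) + y * I)‖ ≤ 288 * K * ε :=
    norm_integral_vertical_sum_le hK hε hε' n
  have b3 : ‖∫ y in ε..(2 * Real.pi - ε), Ψ ((-α : ℝ) + y * I)‖ ≤
      36 * Real.pi * B * Real.exp (-(n * α)) :=
    norm_integral_vertical_inner_le hα hε.le hε'
      (fun y hy => (hB (-α) ⟨le_rfl, by linarith⟩ y hy).2) n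
  have key : (2 * Real.pi) • (a ^ n * ((1 - (2 - w - w⁻¹)) • (1 : A) - a)) =
      (∫ y in (-ε)..ε, Φ (ε + y * I)) + (∫ y in ε..(2 * Real.pi - ε), Ψ ((-α : ℝ) + y * I)) +
      (∫ y in (-ε)..ε, P ((-ε : ℝ) + y * I)) +
      I • ((∫ x in (-α)..ε, Ψ (x + ε * I)) - ∫ x in (-ε)..ε, P (x + ε * I)) -
      I • ((∫ x in (-α)..ε, Ψ (x + (2 * Real.pi - ε : ℝ) * I)) -
        ∫ x in (-ε)..ε, P (x + (2 * Real.pi - ε : ℝ) * I)) := by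
    rw [e1, e2, sub_eq_iff_eq_add.1 e4, sub_eq_iff_eq_add.1 e5, eq_neg_of_add_eq_zero_left e3]
    simp only [smul_sub]
    abel
  have hnorm : ‖(2 * Real.pi) • (a ^ n * ((1 - (2 - w - w⁻¹)) • (1 : A) - a))‖ ≤
      144 * K * ε + 36 * Real.pi * B * Real.exp (-(n * α)) + 288 * K * ε +
      (3 / n * B * α + 6 * K * ε + 3 * K * ε) + (3 / n * B * α + 6 * K * ε + 3 * K * ε) := by
    rw [key]
    refine norm_sub_le_of_le (norm_add_le_of_le (norm_add_le_of_le
      (norm_add_le_of_le b1 b3) b2) ?_) ?_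
    · rwa [norm_smul, norm_I, one_mul]
    · rwa [norm_smul, norm_I, one_mul]
  -- The factor `2π` is discarded, being at least 1. The total constant is `450 = 144 + 288 + 2 (6 +
  -- 3)`.
  have hfin : ‖a ^ n * ((1 - (2 - w - w⁻¹)) • (1 : A) - a)‖ ≤
      ‖(2 * Real.pi) • (a ^ n * ((1 - (2 - w - w⁻¹)) • (1 : A) - a))‖ := by
    rw [norm_smul, Real.norm_eq_abs, abs_of_pos (by linarith)]
    exact le_mul_of_one_le_left (norm_nonneg _) (by linarith)
  calc _ ≤ _ := hfin.trans hnorm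
    _ = _ := by ring

end PowerEstimate

/-! ### Solvability of `mLog m ε = t`. -/

section Rate

theorem continuousOn_mLog {m : ℝ → ℝ} (hcont : ContinuousOn m (Ioc 0 Real.pi))
    (hone : ∀ ε ∈ Ioc 0 Real.pi, 1 ≤ m ε) : ContinuousOn (mLog m) (Ioc 0 Real.pi) := by
  refine hcont.mul (ContinuousOn.log (continuousOn_const.add (hcont.div continuousOn_id
    fun ε hε => hε.1.ne')) fun ε hε => ?_)
  have h1 := hone ε hε
  have h0 : 0 < ε := hε.1
  have : 0 < m ε / ε := by positivity
  positivity

theorem exists_mLog_eq {m : ℝ → ℝ} (hcont : ContinuousOn m (Ioc 0 Real.pi))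
    (hone : ∀ ε ∈ Ioc 0 Real.pi, 1 ≤ m ε) {ε₀ t : ℝ} (hε₀ : ε₀ ∈ Ioc 0 Real.pi)
    (ht : mLog m ε₀ ≤ t) : ∃ ε ∈ Ioc 0 ε₀, mLog m ε = t := by
  -- With `m ≥ 1` and `ε₁ ≤ e^{-t}`, the logarithm alone already reaches `t`; the intermediate value
  -- theorem does the rest.
  set ε₁ := min ε₀ (Real.exp (-t)) with hε₁
  have hpos : 0 < ε₁ := lt_min hε₀.1 (Real.exp_pos _)
  have hle : ε₁ ≤ ε₀ := min_le_left _ _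
  have hm1 := hone ε₁ ⟨hpos, hle.trans hε₀.2⟩
  have h1 : Real.exp t ≤ 1 + m ε₁ / ε₁ := by
    have h2 : Real.exp t ≤ 1 / ε₁ := by
      rw [le_div_iff₀ hpos]
      calc Real.exp t * ε₁ ≤ Real.exp t * Real.exp (-t) := by gcongr; exact min_le_right _ _
        _ = 1 := by rw [← Real.exp_add]; simp
    have h3 : 1 / ε₁ ≤ m ε₁ / ε₁ := by gcongr
    linarith
  have h2 : t ≤ Real.log (1 + m ε₁ / ε₁) := by
    rwa [Real.le_log_iff_exp_le ((Real.exp_pos t).trans_le h1)]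
  have h3 : 0 ≤ Real.log (1 + m ε₁ / ε₁) := by
    have : 0 ≤ m ε₁ / ε₁ := by positivity
    exact Real.log_nonneg (by linarith)
  have h4 : t ≤ mLog m ε₁ := h2.trans (le_mul_of_one_le_left h3 hm1)
  obtain ⟨ε, hε, he⟩ := intermediate_value_Icc' hle
    ((continuousOn_mLog hcont hone).mono fun x hx => ⟨hpos.trans_le hx.1, hx.2.trans hε₀.2⟩)
    ⟨ht, h4⟩
  exact ⟨ε, ⟨hpos.trans_le hε.1, hε.2⟩, he⟩

end Rate

/-! ### Resolvent bounds inside the disc and choice of the parameters. -/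

section ResolventBound

open Complex

variable {A : Type*} [NormedRing A] [NormedAlgebra ℂ A] {a : A}

theorem mem_resolventSet_of_norm_eq_one (hσ : spectrum ℂ a ∩ Metric.sphere (0 : ℂ) 1 = {1}) {l : ℂ}
    (hl : ‖l‖ = 1) (h1 : l ≠ 1) : l ∈ resolventSet ℂ a := by
  by_contra h
  have : l ∈ spectrum ℂ a ∩ Metric.sphere (0 : ℂ) 1 := ⟨h, by simpa using hl⟩
  rw [hσ] at this
  exact h1 this

theorem mem_resolventSet_and_norm_resolvent_circle_le {m : ℝ → ℝ}
    (hσ : spectrum ℂ a ∩ Metric.sphere (0 : ℂ) 1 = {1})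
    (hanti : AntitoneOn m (Ioc 0 Real.pi))
    (hres : ∀ θ : ℝ, 0 < |θ| → |θ| ≤ Real.pi → ‖resolvent a (exp (I * θ))‖ ≤ m |θ|)
    {ε y : ℝ} (hε : 0 < ε) (hy : y ∈ Icc ε (2 * Real.pi - ε)) :
    exp (y * I) ∈ resolventSet ℂ a ∧ ‖resolvent a (exp (y * I))‖ ≤ m ε := by
  have hεπ : ε ≤ Real.pi := by linarith [hy.1, hy.2]
  constructor
  · refine mem_resolventSet_of_norm_eq_one hσ (norm_exp_ofReal_mul_I y) fun h => ?_
    have h1 := norm_exp_sub_one_mono hε.le hy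
    rw [h, sub_self, norm_zero, norm_exp_ofReal_mul_I_sub_one] at h1
    have : 0 < Real.sin (ε / 2) := Real.sin_pos_of_pos_of_lt_pi (by linarith) (by linarith)
    linarith [le_abs_self (Real.sin (ε / 2))]
  · obtain ⟨θ, hθ, hε', hπ'⟩ :
        ∃ θ : ℝ, exp (y * I) = exp (I * θ) ∧ ε ≤ |θ| ∧ |θ| ≤ Real.pi := by
      rcases le_total y Real.pi with h | h
      · have h0 : 0 ≤ y := hε.le.trans hy.1
        exact ⟨y, by rw [mul_comm], by rw [abs_of_nonneg h0]; exact hy.1,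
          by rwa [abs_of_nonneg h0]⟩
      · have h0 : y - 2 * Real.pi ≤ 0 := by linarith [hy.2]
        refine ⟨y - 2 * Real.pi, ?_, ?_, ?_⟩
        · rw [← exp_periodic (I * ((y - 2 * Real.pi : ℝ) : ℂ))]
          congr 1; push_cast; ring
        · rw [abs_of_nonpos h0]; linarith [hy.2]
        · rw [abs_of_nonpos h0]; linarith
    rw [hθ]
    exact (hres θ (hε.trans_le hε') hπ').trans
      (hanti ⟨hε, hεπ⟩ ⟨hε.trans_le hε', hπ'⟩ hε')

variable [CompleteSpace A]

/-- Radial displacement is `1 - e^x ≤ α`, so the Neumann series has ratio at most `c`. This is where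
`c < 1` is needed. -/
theorem norm_resolvent_exp_le_of_circle {M c α : ℝ} (hM : 0 < M) (hc : c < 1) (hα : α * M ≤ c)
    {x y : ℝ} (hx : x ∈ Icc (-α) 0) (hmem : exp (y * I) ∈ resolventSet ℂ a)
    (hR : ‖resolvent a (exp (y * I))‖ ≤ M) :
    exp (x + y * I) ∈ resolventSet ℂ a ∧ ‖resolvent a (exp (x + y * I))‖ ≤ M / (1 - c) := by
  refine norm_resolvent_le_of_norm_sub_mul_le hmem hR hc (le_trans ?_ hα)
  gcongr
  have h : exp (y * I) - exp (x + y * I) = ((1 - Real.exp x : ℝ) : ℂ) * exp (y * I) := by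
    rw [exp_ofReal_add_ofReal_mul_I]; push_cast; ring
  rw [h, norm_mul, norm_exp_ofReal_mul_I, mul_one, norm_real, Real.norm_eq_abs,
    abs_of_nonneg (by linarith [Real.exp_le_one_iff.2 hx.2])]
  linarith [Real.add_one_le_exp x, hx.1]

/-- The spectral point `1` lies within `ε` of `e^{iε}`, and the Neumann disc cannot contain it. -/
theorem one_le_mul_norm_resolvent (h1 : (1 : ℂ) ∈ spectrum ℂ a) {ε M : ℝ} (hε : 0 ≤ ε)
    (hmem : exp (ε * I) ∈ resolventSet ℂ a) (hR : ‖resolvent a (exp (ε * I))‖ ≤ M) :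
    1 ≤ ε * M := by
  by_contra! h
  refine h1 (mem_resolventSet_of_norm_sub_mul_lt hmem (lt_of_le_of_lt ?_ h))
  have := norm_exp_ofReal_mul_I_sub_one_le ε
  rw [abs_of_nonneg hε] at this
  gcongr

theorem norm_pow_mul_one_sub_le_of_mLog_eq {K : ℝ} (hK : ∀ n : ℕ, ‖a ^ n‖ ≤ K) {m : ℝ → ℝ}
    (hσ : spectrum ℂ a ∩ Metric.sphere (0 : ℂ) 1 = {1})
    (hanti : AntitoneOn m (Ioc 0 Real.pi)) (hone : ∀ ε ∈ Ioc 0 Real.pi, 1 ≤ m ε)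
    (hres : ∀ θ : ℝ, 0 < |θ| → |θ| ≤ Real.pi → ‖resolvent a (exp (I * θ))‖ ≤ m |θ|)
    {c : ℝ} (hc : c ∈ Ioo (0 : ℝ) 1) {ε : ℝ} (hε : ε ∈ Ioc (0 : ℝ) (1 / 2)) {n : ℕ}
    (hn : mLog m ε = c * n) :
    ‖a ^ n * (1 - a)‖ ≤ (451 * K + (36 * Real.pi + 12) / (1 - c)) * ε := by
  obtain ⟨hε0, hε1⟩ := hε
  obtain ⟨hc0, hc1⟩ := hc
  have hπ := Real.pi_gt_three
  have hK0 : 0 ≤ K := (norm_nonneg _).trans (hK 0)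
  have hM1 : 1 ≤ m ε := hone ε ⟨hε0, by linarith⟩
  set M := m ε with hMdef
  have hM0 : 0 < M := by linarith
  have hc' : 0 < 1 - c := by linarith
  have hcircle := fun y hy => mem_resolventSet_and_norm_resolvent_circle_le (y := y) hσ hanti hres
    hε0 hy
  have hεM : 1 ≤ ε * M := by
    have h := hcircle ε ⟨le_rfl, by linarith⟩
    have h1 : (1 : ℂ) ∈ spectrum ℂ a ∩ Metric.sphere (0 : ℂ) 1 := hσ ▸ mem_singleton 1
    exact one_le_mul_norm_resolvent h1.1 hε0.le h.1 h.2
  have hlog : 1 / 2 ≤ Real.log (1 + M / ε) := by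
    have h1 : 1 ≤ M / ε := by rw [le_div_iff₀ hε0]; linarith
    have h2 := Real.log_le_log two_pos (by linarith : (2 : ℝ) ≤ 1 + M / ε)
    linarith [Real.log_two_gt_d9]
  have hn' : M * Real.log (1 + M / ε) = c * n := hn
  have hcn : M / 2 ≤ c * n := by
    rw [← hn']; nlinarith
  have hn0 : 0 < (n : ℝ) := by
    by_contra! h
    nlinarith
  have hmain := norm_pow_mul_smul_one_sub_le hK (α := c / M) (B := M / (1 - c)) hε0 hε1
    (by positivity) (fun x hx y hy => norm_resolvent_exp_le_of_circle hM0 hc1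
      (by rw [div_mul_cancel₀ _ hM0.ne']) hx (hcircle y hy).1 (hcircle y hy).2)
    (Nat.cast_pos.1 hn0)
  -- Here `nα = log (1 + M/ε)` exactly, so the left side equals `M ε / (M + ε)`.
  have hexp : M * Real.exp (-(n * (c / M))) ≤ ε := by
    have h1 : (n : ℝ) * (c / M) = Real.log (1 + M / ε) := by
      rw [mul_div_assoc', div_eq_iff hM0.ne', mul_comm, ← hn', mul_comm]
    have h2 : 0 < 1 + M / ε := by positivity
    rw [h1, Real.exp_neg, Real.exp_log h2, ← div_eq_mul_inv, div_le_iff₀ h2, mul_add,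
      mul_div_cancel₀ _ hε0.ne']
    linarith
  -- `M ≤ 2 c n ≤ 2 n` together with `1 ≤ ε M` gives `1 ≤ 2 ε n`.
  have hnε : c / n ≤ 2 * ε := by
    rw [div_le_iff₀ hn0]
    have h1 : 1 ≤ 2 * ε * n := by
      have h2 : ε * M ≤ 2 * ε * n := by
        have : M ≤ 2 * n := by nlinarith
        nlinarith
      linarith
    linarith
  set w := exp (ε * I) with hw
  have hκ : ‖a ^ n * ((2 - w - w⁻¹) • (1 : A))‖ ≤ K * ε := by
    have h1 : ‖w - 1‖ ≤ ε := by
      simpa [abs_of_pos hε0] using norm_exp_ofReal_mul_I_sub_one_le ε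
    rw [mul_smul_comm, mul_one, norm_smul, norm_two_sub_sub_inv (norm_exp_ofReal_mul_I ε),
      mul_comm]
    have h2 : ‖w - 1‖ ^ 2 ≤ ε := by nlinarith [norm_nonneg (w - 1)]
    exact mul_le_mul (hK n) h2 (by positivity) hK0
  have hsplit : a ^ n * (1 - a) = a ^ n * ((1 - (2 - w - w⁻¹)) • (1 : A) - a) +
      a ^ n * ((2 - w - w⁻¹) • (1 : A)) := by
    rw [← mul_add, sub_smul 1, one_smul]; congr 1; abel
  rw [hsplit]
  refine (norm_add_le_of_le hmain hκ).trans ?_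
  calc 450 * K * ε + 36 * Real.pi * (M / (1 - c)) * Real.exp (-(n * (c / M))) +
        6 / n * (M / (1 - c)) * (c / M) + K * ε
      = 451 * K * ε + 36 * Real.pi / (1 - c) * (M * Real.exp (-(n * (c / M)))) +
        6 / (1 - c) * (c / n) := by field_simp; ring
    _ ≤ 451 * K * ε + 36 * Real.pi / (1 - c) * ε + 6 / (1 - c) * (2 * ε) := by gcongr
    _ = _ := by field_simp; ring

end ResolventBound

/-! ### The main theorem. -/

theorem theorem2p4 {X : Type*} [NormedAddCommGroup X] [NormedSpace ℂ X] [CompleteSpace X]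
    (T : X →L[ℂ] X) (hT : IsPowerBounded T)
    (hσ : spectrum ℂ T ∩ Metric.sphere (0 : ℂ) 1 = {1})
    (m : ℝ → ℝ) (hcont : ContinuousOn m (Ioc 0 Real.pi))
    (hanti : AntitoneOn m (Ioc 0 Real.pi)) (hone : ∀ ε ∈ Ioc 0 Real.pi, 1 ≤ m ε)
    (hres : ∀ θ : ℝ, 0 < |θ| → |θ| ≤ Real.pi →
      ‖resolvent T (Complex.exp (Complex.I * θ))‖ ≤ m |θ|)
    (c : ℝ) (hc : c ∈ Ioo (0 : ℝ) 1) :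
    (∀ᶠ n : ℕ in atTop, c * n ∈ mLog m '' Ioc 0 Real.pi) ∧
      (fun n : ℕ => ‖T ^ n * (1 - T)‖) =O[atTop] (fun n : ℕ => mLogInv m (c * n)) := by
  obtain ⟨K, hK⟩ := hT
  have hK' : ∀ n : ℕ, ‖T ^ n‖ ≤ K := fun n => hK (mem_range_self n)
  have hhalf : (1 / 2 : ℝ) ∈ Ioc 0 Real.pi := ⟨by norm_num, by linarith [Real.pi_gt_three]⟩
  -- Solutions are sought in `(0, 1/2]` because the contour estimates require `ε ≤ 1/2`.
  have hlarge : ∀ᶠ n : ℕ in atTop, ∃ ε ∈ Ioc (0 : ℝ) (1 / 2), mLog m ε = c * n := by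
    have ht : Tendsto (fun n : ℕ => c * (n : ℝ)) atTop atTop :=
      tendsto_natCast_atTop_atTop.const_mul_atTop hc.1
    filter_upwards [ht.eventually_ge_atTop (mLog m (1 / 2))] with n hn
    exact exists_mLog_eq hcont hone hhalf hn
  constructor
  · filter_upwards [hlarge] with n hn
    obtain ⟨ε, hε, he⟩ := hn
    exact ⟨ε, ⟨hε.1, hε.2.trans hhalf.2⟩, he⟩
  · refine IsBigO.of_bound (451 * K + (36 * Real.pi + 12) / (1 - c)) ?_
    filter_upwards [hlarge] with n hn
    obtain ⟨ε, hε, he⟩ := hn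
    rw [← he, mLogInv_mLog hanti hone ⟨hε.1, hε.2.trans hhalf.2⟩, norm_norm,
      Real.norm_of_nonneg hε.1.le]
    exact norm_pow_mul_one_sub_le_of_mLog_eq hK' hσ hanti hone hres hc hε he
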